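/- **Setting.** Let $G=(V,E)$ be a connected graph on $n$ nodes, $\theta:V\to\{2,\dots,n\}$ a threshold function, and $s\in V$ a node (the one assumed to activate first). Timesteps are $1,\dots,n$, and the variables are $x_{v,t}$ for $v\in V$, $1\le t\le n$. *Simple IP.* Constraints: $x_{v,t}\in\{0,1\}$; $\sum_{t}x_{v,t}=1$ for all $v$; $\sum_v x_{v,t}=1$ for all $t$; and $\sum_{\{v,w\}\in E}\sum_{t'<t}x_{w,t'}\ge x_{v,t}$ for all $v$ and all $t>1$. *Flow network $\mathcal H$.* It has nodes $X_{v,t}$ with capacity $x_{v,t}$, and uncapacitated directed edges $(X_{v,t},X_{v',t'})$ whenever $t<t'$ and $\{v,v'\}\in E$. For $\theta(v)\le t\le n$, the $(v,t)$-flow problem on $\mathcal H$ has source $X_{s,1}$ and sinks $X_{v,\tau}$, $\theta(v)\le\tau\le t$, with demands $x_{v,\tau}$. *Augmented IP.* The simple IP with the additional constraints that $x_{s,1}=1$ and that every $(v,t)$-flow problem with $\theta(v)\le t\le n$ has a solution. Its LP relaxation replaces $x_{v,t}\in\{0,1\}$ by $x_{v,t}\in[0,1]$. *Glue$(S)$.*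 While $S$ does not induce a connected subgraph of $G$: let $C$ be a largest connected component of the subgraph induced by $S$, pick $u\in S\setminus C$, and add to $S$ the nodes of a shortest path in $G$ from $u$ to $C$. Return $S$. (The empty set counts as connected.) *Get-Seq$(\mathcal H,S)$.* Set flags $b_{u,t}=1$ for all $t$ if $u\in S$, and $b_{u,t}=0$ for all $t$ otherwise. For $t=1,\dots,n$: for every $u$ with $t\ge\theta(u)$, if some edge $(X_{v,\tau},X_{u,t})$ of $\mathcal H$ has $b_{v,\tau}=1$, set $b_{u,t'}=1$ for all $t'\ge t$. Return $T$ with $T(u)=\min\{t:b_{u,t}=1\}$, and $T(u)=\infty$ if there is no such $t$. **Proposition 3.1.** (a) Get-Seq is efficiently computable: a single program computes $T$ from $(G,\theta,S)$ in a number of steps polynomial in $n$. (b) A $0/1$ vector $x$ is feasible for the augmented IP if and only if it is feasible for the simple IP and $x_{s,1}=1$. Glue terminates on every $S\subseteq V$, whatever choices it makes. (c) Let $0<\varepsilon\le n^2$ and $\alpha=24(1+\varepsilon)\ln(4n^2/\varepsilon)$, and let $x$ be any feasible solution of the LP relaxation of the augmented IP. Sample $S_0\subseteq V$ by including each $v$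 independently with probability $\min\{1,\alpha\sum_{t<\theta(v)}x_{v,t}\}$. Put $S=\mathrm{Glue}(S_0)$, for any fixed rule for the choices in Glue, and $T=\text{Get-Seq}(\mathcal H,S)$. Then: 1. $T$ is connected: for every timestep $t$, the set $\{v:T(v)\le t\}$ induces a connected subgraph of $G$; this set is almost surely non-empty. 2. $T(v)\ge\theta(v)$ for every $v\notin S$. 3. For every node $v$ and every timestep $t$: - if $\sum_{t'\le t}x_{v,t'}\ge\frac1{12(1+\varepsilon)}$, then $\Pr[T(v)\le t]\ge 1-\frac{\varepsilon}{4n^2}$; - if $\sum_{t'\le t}x_{v,t'}<\frac1{12(1+\varepsilon)}$, then $\Pr[T(v)\le t]\ge(1+\varepsilon)\sum_{t'\le t}x_{v,t'}$. -/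

import Mathlib

namespace TechDiffusion

/-! The nodes of the network are the elements of `Fin n`, and the timesteps are `1, ..., n`.
The unknowns of the programs are `x v t` for a node `v` and a timestep `t`; values of `x` outside
`1 ≤ t ≤ n` are never used. -/

/-- The linear relaxation of the simple integer program: permutation constraints and connectivity
constraints, with `x v t ∈ [0, 1]`. -/
structure SimpleLP {n : ℕ} (G : SimpleGraph (Fin n)) (x : Fin n → ℕ → ℝ) : Prop where
  nonneg : ∀ v, ∀ t ∈ Finset.Icc 1 n, 0 ≤ x v t
  le_one : ∀ v, ∀ t ∈ Finset.Icc 1 n, x v t ≤ 1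
  sum_time : ∀ v, ∑ t ∈ Finset.Icc 1 n, x v t = 1
  sum_node : ∀ t ∈ Finset.Icc 1 n, ∑ v, x v t = 1
  connectivity : ∀ v, ∀ t ∈ Finset.Icc 1 n, 1 < t →
    x v t ≤ ∑ w, open Classical in
      if G.Adj v w then ∑ t' ∈ Finset.Ico 1 t, x w t' else 0

/-- Integrality: all variables are `0` or `1`. -/
def IsIntegral {n : ℕ} (x : Fin n → ℕ → ℝ) : Prop :=
  ∀ v, ∀ t ∈ Finset.Icc 1 n, x v t = 0 ∨ x v t = 1

/-- The vertices `X_{v,t}` of the flow network `H`, as pairs `(v, t)`. -/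
def flowNodes (n : ℕ) : Finset (Fin n × ℕ) :=
  Finset.univ ×ˢ Finset.Icc 1 n

/-- The directed edges of the flow network `H`: from `X_{v,t}` to `X_{v',t'}` whenever `v, v'` are
adjacent in `G` and `t < t'`. -/
def FlowEdge {n : ℕ} (G : SimpleGraph (Fin n)) (p q : Fin n × ℕ) : Prop :=
  p ∈ flowNodes n ∧ q ∈ flowNodes n ∧ G.Adj p.1 q.1 ∧ p.2 < q.2

/-- Total flow entering `q`. -/
def inflow {n : ℕ} (f : Fin n × ℕ → Fin n × ℕ → ℝ) (q : Fin n × ℕ) : ℝ :=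
  ∑ p ∈ flowNodes n, f p q

/-- Total flow leaving `p`. -/
def outflow {n : ℕ} (f : Fin n × ℕ → Fin n × ℕ → ℝ) (p : Fin n × ℕ) : ℝ :=
  ∑ q ∈ flowNodes n, f p q

/-- `f` solves the `(u, t)`-flow problem over `H`: the node capacities are `x`, the source is
`X_{s,1}`, and the sinks are `X_{u,τ}` for `θ u ≤ τ ≤ t`, with demand `x u τ`. -/
structure SolvesFlow {n : ℕ} (G : SimpleGraph (Fin n)) (θ : Fin n → ℕ) (s : Fin n)
    (x : Fin n → ℕ → ℝ) (u : Fin n) (t : ℕ) (f : Fin n × ℕ → Fin n × ℕ → ℝ) : Prop where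
  nonneg : ∀ p q, 0 ≤ f p q
  support : ∀ p q, ¬ FlowEdge G p q → f p q = 0
  inflow_le : ∀ p ∈ flowNodes n, inflow f p ≤ x p.1 p.2
  outflow_le : ∀ p ∈ flowNodes n, outflow f p ≤ x p.1 p.2
  demand : ∀ τ, θ u ≤ τ → τ ≤ t → inflow f (u, τ) - outflow f (u, τ) = x u τ
  conservation : ∀ p ∈ flowNodes n, p ≠ (s, 1) → ¬ (p.1 = u ∧ θ u ≤ p.2 ∧ p.2 ≤ t) →
    inflow f p = outflow f p

/-- The linear relaxation of the augmented integer program: the relaxation of the simple program,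
the constraint `x s 1 = 1` for the node `s` that activates first, and the flow constraints. -/
structure AugmentedLP {n : ℕ} (G : SimpleGraph (Fin n)) (θ : Fin n → ℕ) (s : Fin n)
    (x : Fin n → ℕ → ℝ) : Prop where
  simple : SimpleLP G x
  source : x s 1 = 1
  flow : ∀ u t, θ u ≤ t → t ≤ n → ∃ f, SolvesFlow G θ s x u t f

/-- The feasible solutions of the simple integer program. -/
def SimpleIP {n : ℕ} (G : SimpleGraph (Fin n)) (x : Fin n → ℕ → ℝ) : Prop :=
  SimpleLP G x ∧ IsIntegral x

/-- The feasible solutions of the augmented integer program. -/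
def AugmentedIP {n : ℕ} (G : SimpleGraph (Fin n)) (θ : Fin n → ℕ) (s : Fin n)
    (x : Fin n → ℕ → ℝ) : Prop :=
  AugmentedLP G θ s x ∧ IsIntegral x

/-- `S` induces a connected subgraph of `G` (the empty set counts as connected). -/
def IsConn {n : ℕ} (G : SimpleGraph (Fin n)) (S : Set (Fin n)) : Prop :=
  (G.induce S).Preconnected

/-- `C` is (the vertex set of) a connected component of the subgraph of `G` induced by `S`. -/
def IsComponent {n : ℕ} (G : SimpleGraph (Fin n)) (S C : Finset (Fin n)) : Prop :=
  C.Nonempty ∧ C ⊆ S ∧ IsConn G C ∧ ∀ D : Finset (Fin n), C ⊆ D → D ⊆ S → IsConn G D → D = C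

/-- One pass through the loop of `Glue`: `S` is not connected, `C` is a largest component of the
subgraph induced by `S`, `u ∈ S \ C`, and `S'` results from adding to `S` the nodes of a shortest
path `P` of `G` among those that lead from `u` to `C`. -/
def GlueStep {n : ℕ} (G : SimpleGraph (Fin n)) (S S' : Finset (Fin n)) : Prop :=
  ¬ IsConn G S ∧
  ∃ C : Finset (Fin n), IsComponent G S C ∧
    (∀ D : Finset (Fin n), IsComponent G S D → D.card ≤ C.card) ∧
    ∃ u ∈ S \ C, ∃ w ∈ C, ∃ P : G.Walk u w,
      (∀ w' ∈ C, ∀ Q : G.Walk u w', P.length ≤ Q.length) ∧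
      S' = S ∪ P.support.toFinset

/-- `Glue`, started with `S`, can return `S'` (`Glue` leaves the choices of `C`, `u`, `P` open). -/
def GlueReturns {n : ℕ} (G : SimpleGraph (Fin n)) (S S' : Finset (Fin n)) : Prop :=
  Relation.ReflTransGen (GlueStep G) S S' ∧ IsConn G S'

/-- The flags `b_{u,τ}` of `Get-Seq` after the first `k` iterations of its loop. -/
def flag {n : ℕ} (G : SimpleGraph (Fin n)) (θ : Fin n → ℕ) (S : Finset (Fin n)) :
    ℕ → Fin n × ℕ → Prop
  | 0, p => p.1 ∈ S
  | k + 1, p => flag G θ S k p ∨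
      (θ p.1 ≤ k + 1 ∧ k + 1 ≤ p.2 ∧ ∃ q, FlowEdge G q (p.1, k + 1) ∧ flag G θ S k q)

/-- `Get-Seq`: `T(u)` is the least timestep `t` with `b_{u,t} = 1`, and `⊤` if there is none,
i.e. if `u` never activates. -/
noncomputable def getSeq {n : ℕ} (G : SimpleGraph (Fin n)) (θ : Fin n → ℕ)
    (S : Finset (Fin n)) (u : Fin n) : ℕ∞ :=
  sInf {a : ℕ∞ | ∃ t : ℕ, 1 ≤ t ∧ t ≤ n ∧ flag G θ S n (u, t) ∧ a = t}

/-- The set of nodes that are active at timestep `t`. -/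
def activeAt {n : ℕ} (T : Fin n → ℕ∞) (t : ℕ) : Set (Fin n) := {v | T v ≤ t}

/-- The activation function `T` is connected: at every timestep the active nodes induce a
connected subgraph. -/
def IsConnectedSeq {n : ℕ} (G : SimpleGraph (Fin n)) (T : Fin n → ℕ∞) : Prop :=
  ∀ t, 1 ≤ t → t ≤ n → IsConn G (activeAt T t)

/-- The seed weight `∑_{t < θ(v)} x_{v,t}`. -/
noncomputable def seedWeight {n : ℕ} (θ : Fin n → ℕ) (x : Fin n → ℕ → ℝ) (v : Fin n) : ℝ :=
  ∑ t ∈ (Finset.Icc 1 n).filter (fun t => t < θ v), x v t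

/-- The sampling bias `α`. -/
noncomputable def samplingBias (n : ℕ) (ε : ℝ) : ℝ :=
  24 * (1 + ε) * Real.log (4 * (n : ℝ) ^ 2 / ε)

/-- `S₀` is a random set of nodes on a probability space, which contains each `v` independently
with probability `min {1, α ∑_{t < θ(v)} x_{v,t}}`. -/
structure IsSeedSample {n : ℕ} (θ : Fin n → ℕ) (x : Fin n → ℕ → ℝ) (α : ℝ)
    {Ω : Type*} [MeasurableSpace Ω] (μ : MeasureTheory.Measure Ω)
    (S₀ : Ω → Finset (Fin n)) : Prop where
  measurable : ∀ v, MeasurableSet {ω | v ∈ S₀ ω}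
  prob : ∀ v, μ {ω | v ∈ S₀ ω} = ENNReal.ofReal (min 1 (α * seedWeight θ x v))
  indep : ProbabilityTheory.iIndepSet (fun v => {ω | v ∈ S₀ ω}) μ

/-! Efficient computability. The machine has registers and two-dimensional arrays of natural
numbers. Every elementary instruction and every pass through a loop costs one step. The only
arithmetic operation is the successor, so that numbers grow by at most one per step, and a
polynomial bound on the steps is a polynomial bound on the running time in the usual sense. -/

/-- Memory: the registers and the two-dimensional arrays. -/
structure Memory where
  reg : ℕ → ℕ
  arr : ℕ → ℕ → ℕ → ℕ

/-- Assign `val` to register `r`. -/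
def Memory.setReg (m : Memory) (r val : ℕ) : Memory :=
  ⟨Function.update m.reg r val, m.arr⟩

/-- Assign `val` to the entry `(i, j)` of array `a`. -/
def Memory.setArr (m : Memory) (a i j val : ℕ) : Memory :=
  ⟨m.reg, Function.update m.arr a
    (Function.update (m.arr a) i (Function.update (m.arr a i) j val))⟩

/-- Programs. -/
inductive Prog where
  /-- register `r` becomes `0` -/
  | zero (r : ℕ) : Prog
  /-- register `r` is incremented -/
  | succ (r : ℕ) : Prog
  /-- register `r` becomes the content of register `r'` -/
  | copy (r r' : ℕ) : Prog
  /-- register `r` becomes the entry of array `a` indexed by registers `i`, `j` -/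
  | load (r a i j : ℕ) : Prog
  /-- the entry of array `a` indexed by registers `i`, `j` becomes the content of register `r` -/
  | store (a i j r : ℕ) : Prog
  /-- `p`, then `q` -/
  | seq (p q : Prog) : Prog
  /-- if register `r` is less than register `r'` then `p` else `q` -/
  | ifLt (r r' : ℕ) (p q : Prog) : Prog
  /-- repeat `p` as often as register `r` says when the loop is entered -/
  | loop (r : ℕ) (p : Prog) : Prog

/-- The final memory and the number of steps of a run. -/
def Prog.run : Prog → Memory → Memory × ℕ
  | .zero r, m => (m.setReg r 0, 1)
  | .succ r, m => (m.setReg r (m.reg r + 1), 1)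
  | .copy r r', m => (m.setReg r (m.reg r'), 1)
  | .load r a i j, m => (m.setReg r (m.arr a (m.reg i) (m.reg j)), 1)
  | .store a i j r, m => (m.setArr a (m.reg i) (m.reg j) (m.reg r), 1)
  | .seq p q, m => ((q.run (p.run m).1).1, (p.run m).2 + (q.run (p.run m).1).2)
  | .ifLt r r' p q, m =>
      if m.reg r < m.reg r' then ((p.run m).1, (p.run m).2 + 1)
      else ((q.run m).1, (q.run m).2 + 1)
  | .loop r p, m =>
      (fun c : Memory × ℕ => ((p.run c.1).1, c.2 + (p.run c.1).2 + 1))^[m.reg r] (m, 1)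

/-- The input `(G, θ, S)` in memory: register `0` holds `n`, array `0` the adjacency matrix of `G`,
array `1` the thresholds, array `2` the indicator of `S`; all else is `0`. -/
noncomputable def encodeInput {n : ℕ} (G : SimpleGraph (Fin n)) (θ : Fin n → ℕ)
    (S : Finset (Fin n)) : Memory where
  reg := fun r => if r = 0 then n else 0
  arr := fun a i j => open Classical in
    if a = 0 then (if ∃ u v : Fin n, u.val = i ∧ v.val = j ∧ G.Adj u v then 1 else 0)
    else if a = 1 then (if h : i < n ∧ j = 0 then θ ⟨i, h.1⟩ else 0)
    else if a = 2 then (if ∃ u ∈ S, u.val = i ∧ j = 0 then 1 else 0)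
    else 0

/-- `m` holds the activation function `T` in array `3`: the entry of a node is its activation time,
which is positive, or `0` for a node that never activates. -/
def HoldsOutput {n : ℕ} (m : Memory) (T : Fin n → ℕ∞) : Prop :=
  ∀ u : Fin n, (T u = ⊤ ∧ m.arr 3 u 0 = 0) ∨ (T u = (m.arr 3 u 0 : ℕ) ∧ 1 ≤ m.arr 3 u 0)

/-- `F` is computed by one program, on all inputs, in a number of steps polynomial in `n`. -/
def EfficientlyComputable
    (F : ∀ n : ℕ, SimpleGraph (Fin n) → (Fin n → ℕ) → Finset (Fin n) → Fin n → ℕ∞) : Prop :=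
  ∃ (p : Prog) (b : Polynomial ℕ),
    ∀ (n : ℕ) (G : SimpleGraph (Fin n)) (θ : Fin n → ℕ) (S : Finset (Fin n)),
      (p.run (encodeInput G θ S)).2 ≤ b.eval n ∧
      HoldsOutput (p.run (encodeInput G θ S)).1 (F n G θ S)

end TechDiffusion

namespace TechDiffusion

/-! ### Flags of Get-Seq and the activation times they define. -/

section Flags

variable {n : ℕ} {G : SimpleGraph (Fin n)} {θ : Fin n → ℕ} {S : Finset (Fin n)}

/-! The probability bounds rest on a cut argument. Call `X_{w,τ}` early if `τ < θ w` and late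
otherwise. In the `(v, t)`-flow problem let `R` be the vertices leading to a sink through late
vertices only. All edges entering `R` come from early vertices, so the late mass of `v` up to `t` is
at most the capacity of those early vertices, hence at most the seed weight of the critical nodes
`w` owning them (`sum_late_le`). A seeded critical node is flagged at all times, and its flag
travels along late vertices to a sink, so it activates `v` by `t`. The early mass of `v` is bounded
by its own seed weight. Hence `v` and its critical nodes form a set `W` of seed weight at least half
of `∑_{t' ≤ t} x_{v,t'}`, and sampling one element of `W` suffices (`exists_activating_set`). By
independence all of `W` is missed with probability at most `exp (-α ∑ seedWeight)`; calculus does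
the rest. Glue only enlarges the seed set, which preserves these activations.

Connectedness of `T` is inherited from the glued seeds, since each later activation is attached to a
node active before. Glue terminates because each pass strictly enlarges `S`. An integral solution of
the simple program satisfies the flow constraints because earlier active neighbours can be followed
back to `X_{s,1}`. For the running time, a three-fold loop over time and pairs of nodes maintains
the activation times in place. -/

theorem flag_mono_iter {k k' : ℕ} (h : k ≤ k') {p : Fin n × ℕ} (hp : flag G θ S k p) :
    flag G θ S k' p := by
  induction h with
  | refl => exact hp
  | step _ ih => exact Or.inl ih

theorem flag_mono_time {k : ℕ} {u : Fin n} {t t' : ℕ} (h : t ≤ t') (hp : flag G θ S k (u, t)) :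
    flag G θ S k (u, t') := by
  induction k with
  | zero => exact hp
  | succ k ih =>
    rcases hp with hp | ⟨h1, h2, h3⟩
    · exact Or.inl (ih hp)
    · exact Or.inr ⟨h1, h2.trans h, h3⟩

/-- Pass `k` writes only to times at least `k`, so passes after `t` leave the flags of time `t`
alone. -/
theorem flag_at_time {k t : ℕ} {u : Fin n} (hp : flag G θ S k (u, t)) :
    flag G θ S t (u, t) := by
  induction k with
  | zero => exact flag_mono_iter (Nat.zero_le t) hp
  | succ k ih =>
    rcases hp with hp | ⟨h1, h2, h3⟩
    · exact ih hp
    · exact flag_mono_iter h2 (Or.inr ⟨h1, h2, h3⟩)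

theorem flag_of_mem (k : ℕ) {p : Fin n × ℕ} (h : p.1 ∈ S) : flag G θ S k p :=
  flag_mono_iter (Nat.zero_le k) h

theorem getSeq_le_iff {t : ℕ} (h1 : 1 ≤ t) (hn : t ≤ n) (u : Fin n) :
    getSeq G θ S u ≤ t ↔ flag G θ S n (u, t) := by
  constructor
  · intro h
    have hne : {a : ℕ∞ | ∃ t : ℕ, 1 ≤ t ∧ t ≤ n ∧ flag G θ S n (u, t) ∧ a = t}.Nonempty := by
      by_contra hc
      rw [Set.not_nonempty_iff_eq_empty] at hc
      rw [getSeq, hc, sInf_empty] at h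
      exact absurd h (by simp)
    obtain ⟨t', -, -, hf, he⟩ := csInf_mem hne
    rw [getSeq, he] at h
    exact flag_mono_time (by exact_mod_cast h) hf
  · intro h
    exact sInf_le ⟨t, h1, hn, h, rfl⟩

theorem getSeq_eq_top_or (u : Fin n) : getSeq G θ S u = ⊤ ∨
    ∃ t : ℕ, 1 ≤ t ∧ t ≤ n ∧ getSeq G θ S u = t := by
  by_cases h : {a : ℕ∞ | ∃ t : ℕ, 1 ≤ t ∧ t ≤ n ∧ flag G θ S n (u, t) ∧ a = t}.Nonempty
  · obtain ⟨t, h1, h2, -, he⟩ := csInf_mem h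
    exact Or.inr ⟨t, h1, h2, he⟩
  · rw [Set.not_nonempty_iff_eq_empty] at h
    left
    rw [getSeq, h, sInf_empty]

theorem threshold_le_of_flag {k t : ℕ} {u : Fin n} (hu : u ∉ S) (h : flag G θ S k (u, t)) :
    θ u ≤ t := by
  induction k with
  | zero => exact absurd h hu
  | succ k ih =>
    rcases h with h | ⟨h1, h2, -⟩
    · exact ih h
    · exact h1.trans h2

theorem threshold_le_getSeq {u : Fin n} (hu : u ∉ S) : (θ u : ℕ∞) ≤ getSeq G θ S u := by
  rcases getSeq_eq_top_or (G := G) (θ := θ) (S := S) u with h | ⟨t, h1, h2, h⟩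
  · simp [h]
  · rw [h]
    have := (getSeq_le_iff h1 h2 u).1 h.le
    exact_mod_cast threshold_le_of_flag hu this

theorem activeAt_getSeq {t : ℕ} (h1 : 1 ≤ t) (hn : t ≤ n) :
    activeAt (getSeq G θ S) t = {u | flag G θ S t (u, t)} := by
  ext u
  simp only [activeAt, Set.mem_ofPred_eq, getSeq_le_iff h1 hn]
  exact ⟨flag_at_time, flag_mono_iter hn⟩

end Flags

/-! ### Connected sets, and connectedness of the activation sequence. -/

section Connectivity

variable {n : ℕ} {G : SimpleGraph (Fin n)}

theorem isConn_iff {A : Set (Fin n)} : IsConn G A ↔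
    ∀ u (hu : u ∈ A) v (hv : v ∈ A), (G.induce A).Reachable ⟨u, hu⟩ ⟨v, hv⟩ :=
  ⟨fun h u hu v hv => h ⟨u, hu⟩ ⟨v, hv⟩, fun h u v => h u u.2 v v.2⟩

theorem reachable_induce_mono {A B : Set (Fin n)} (h : A ⊆ B) {u v : Fin n} {hu : u ∈ A}
    {hv : v ∈ A} (hr : (G.induce A).Reachable ⟨u, hu⟩ ⟨v, hv⟩) :
    (G.induce B).Reachable ⟨u, h hu⟩ ⟨v, h hv⟩ :=
  hr.map (SimpleGraph.induceHomOfLE G h).toHom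

theorem isConn_of_attached {A B : Set (Fin n)} (hA : IsConn G A) (hAB : A ⊆ B)
    (h : ∀ u ∈ B, u ∈ A ∨ ∃ v ∈ A, G.Adj v u) : IsConn G B := by
  have key : ∀ u (hu : u ∈ B), ∃ v, ∃ hv : v ∈ A,
      (G.induce B).Reachable ⟨u, hu⟩ ⟨v, hAB hv⟩ := by
    intro u hu
    rcases h u hu with h | ⟨v, hv, ha⟩
    · exact ⟨u, h, SimpleGraph.Reachable.refl _⟩
    · refine ⟨v, hv, SimpleGraph.Adj.reachable ?_⟩
      exact ha.symm
  rw [isConn_iff] at hA ⊢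
  intro u hu v hv
  obtain ⟨u', hu', h1⟩ := key u hu
  obtain ⟨v', hv', h2⟩ := key v hv
  exact h1.trans ((reachable_induce_mono hAB (hA u' hu' v' hv')).trans h2.symm)

theorem isConn_union {A B : Set (Fin n)} (hA : IsConn G A) (hB : IsConn G B)
    {c : Fin n} (hcA : c ∈ A) (hcB : c ∈ B) : IsConn G (A ∪ B) := by
  rw [isConn_iff] at hA hB ⊢
  have key : ∀ u (hu : u ∈ A ∪ B),
      (G.induce (A ∪ B)).Reachable ⟨u, hu⟩ ⟨c, Or.inl hcA⟩ := by
    rintro u (hu | hu)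
    · exact reachable_induce_mono Set.subset_union_left (hA u hu c hcA)
    · exact reachable_induce_mono Set.subset_union_right (hB u hu c hcB)
  intro u hu v hv
  exact (key u hu).trans (key v hv).symm

theorem isConn_support {u w : Fin n} (P : G.Walk u w) : IsConn G {v | v ∈ P.support} :=
  P.connected_induce_support.preconnected

/-- Induction on time from the connected seed set: a node first active at `k + 1` is adjacent to one
active at `k`. -/
theorem isConnectedSeq_getSeq {θ : Fin n → ℕ} {S : Finset (Fin n)} (hS : IsConn G S) :
    IsConnectedSeq G (getSeq G θ S) := by
  intro t h1 hn
  rw [activeAt_getSeq h1 hn]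
  clear h1 hn
  induction t with
  | zero =>
    exact hS
  | succ k ih =>
    refine isConn_of_attached ih (fun u hu => ?_) (fun u hu => ?_)
    · exact flag_mono_iter k.le_succ (flag_mono_time k.le_succ hu)
    · rcases hu with hu | ⟨-, -, ⟨v, τ⟩, ⟨hq, -, ha, hlt⟩, hf⟩
      · left
        -- A pass `j ≤ k` that flags `u` at time `k + 1` flags it from time `j` on, hence already at
        -- time `k`.
        have : ∀ j ≤ k, flag G θ S j (u, k + 1) → flag G θ S k (u, k) := by
          intro j
          induction j with
          | zero => exact fun _ h => flag_of_mem k h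
          | succ j ihj =>
            rintro hj (h | ⟨h2, h3, h4⟩)
            · exact ihj (by omega) h
            · exact flag_mono_iter hj (Or.inr ⟨h2, hj, h4⟩)
        exact this k le_rfl hu
      · right
        exact ⟨v, flag_mono_time (Nat.lt_succ_iff.1 hlt) hf, ha⟩

end Connectivity

/-! ### Termination of Glue. -/

section Glue

variable {n : ℕ} {G : SimpleGraph (Fin n)}

theorem GlueStep.subset {S S' : Finset (Fin n)} (h : GlueStep G S S') : S ⊆ S' := by
  obtain ⟨-, C, -, -, u, -, w, -, P, -, rfl⟩ := h
  exact Finset.subset_union_left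

/-- If the path stayed inside `S`, then `C` together with the path would be a connected subset of
`S` containing `u ∉ C`, against the maximality of the component `C`. -/
theorem GlueStep.ssubset {S S' : Finset (Fin n)} (h : GlueStep G S S') : S ⊂ S' := by
  refine h.subset.ssubset_of_ne ?_
  obtain ⟨-, C, ⟨-, hCS, hC, hmax⟩, -, u, hu, w, hw, P, -, rfl⟩ := h
  intro he
  have hP : P.support.toFinset ⊆ S := by
    rw [he]; exact Finset.subset_union_right
  have hconn : IsConn G ((C ∪ P.support.toFinset : Finset (Fin n)) : Set (Fin n)) := by
    have := isConn_union hC (isConn_support P) (c := w) hw P.end_mem_support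
    convert this using 1
    ext; simp
  have := hmax _ Finset.subset_union_left (Finset.union_subset hCS hP) hconn
  have hmem : u ∈ C ∪ P.support.toFinset := by simp
  rw [this] at hmem
  exact (Finset.mem_sdiff.1 hu).2 hmem

theorem wellFounded_glueStep (G : SimpleGraph (Fin n)) :
    WellFounded (fun S' S : Finset (Fin n) => GlueStep G S S') :=
  Subrelation.wf (fun {_ _} h => GlueStep.ssubset h)
    (wellFounded_gt : WellFounded (fun a b : Finset (Fin n) => a > b))

/-- A nonempty connected subset of `S` of maximum cardinality is automatically a component. -/
theorem exists_largest_component {S : Finset (Fin n)} (hS : S.Nonempty) :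
    ∃ C, IsComponent G S C ∧ ∀ D, IsComponent G S D → D.card ≤ C.card := by
  classical
  obtain ⟨v, hv⟩ := hS
  obtain ⟨C, hC, hmax⟩ := Finset.exists_max_image
    (S.powerset.filter fun D : Finset (Fin n) => D.Nonempty ∧ IsConn G (D : Set (Fin n))) Finset.card
    ⟨{v}, by
      simp only [Finset.mem_filter, Finset.mem_powerset, Finset.singleton_subset_iff, hv,
        Finset.singleton_nonempty, true_and, Finset.coe_singleton]
      rw [isConn_iff]
      rintro a ha b hb
      obtain rfl : a = v := ha
      obtain rfl : b = a := hb
      exact SimpleGraph.Reachable.refl _⟩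
  simp only [Finset.mem_filter, Finset.mem_powerset] at hC hmax
  refine ⟨C, ⟨hC.2.1, hC.1, hC.2.2, fun D hCD hDS hD => ?_⟩, fun D hD => ?_⟩
  · exact (Finset.eq_of_subset_of_card_le hCD (hmax D ⟨hDS, hC.2.1.mono hCD, hD⟩)).symm
  · exact hmax D ⟨hD.2.1, hD.1, hD.2.2.1⟩

theorem exists_glueStep (hG : G.Connected) {S : Finset (Fin n)} (hS : ¬ IsConn G S) :
    ∃ S', GlueStep G S S' := by
  classical
  have hne : S.Nonempty := by
    rw [Finset.nonempty_iff_ne_empty]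
    rintro rfl
    exact hS (isConn_iff.2 (by simp))
  obtain ⟨C, hC, hmax⟩ := exists_largest_component (G := G) hne
  have hex : ∃ u, u ∈ S \ C := by
    by_contra! hc
    refine hS ?_
    have : S = C := (Finset.sdiff_eq_empty_iff_subset.1
      (Finset.eq_empty_of_forall_notMem hc)).antisymm hC.2.1
    rw [this]; exact hC.2.2.1
  obtain ⟨u, hu⟩ := hex
  have hl : ∃ l, ∃ w ∈ C, ∃ P : G.Walk u w, P.length = l := by
    obtain ⟨w, hw⟩ := hC.1
    obtain ⟨P⟩ := hG.preconnected u w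
    exact ⟨_, w, hw, P, rfl⟩
  obtain ⟨w, hw, P, hP⟩ := Nat.find_spec hl
  exact ⟨_, hS, C, hC, hmax, u, hu, w, hw, P,
    fun w' hw' Q => hP ▸ Nat.find_min' hl ⟨w', hw', Q, rfl⟩, rfl⟩

theorem exists_glueReturns (hG : G.Connected) (S : Finset (Fin n)) :
    ∃ S', GlueReturns G S S' := by
  induction S using (wellFounded_glueStep G).induction with
  | _ S ih =>
    by_cases hS : IsConn G (S : Set (Fin n))
    · exact ⟨S, .refl, hS⟩
    · obtain ⟨S₁, h₁⟩ := exists_glueStep hG hS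
      obtain ⟨S₂, h₂, hc⟩ := ih S₁ h₁
      exact ⟨S₂, .head h₁ h₂, hc⟩

theorem GlueReturns.subset {S S' : Finset (Fin n)} (h : GlueReturns G S S') : S ⊆ S' := by
  obtain ⟨h, -⟩ := h
  induction h with
  | refl => exact subset_rfl
  | tail _ hs ih => exact ih.trans hs.subset

end Glue

/-! ### Integral solutions satisfy the flow constraints. -/

section IntegralFlow

variable {n : ℕ} {G : SimpleGraph (Fin n)}

theorem mem_flowNodes {p : Fin n × ℕ} : p ∈ flowNodes n ↔ 1 ≤ p.2 ∧ p.2 ≤ n := by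
  simp [flowNodes]

theorem exists_activation_time {x : Fin n → ℕ → ℝ} (hx : SimpleLP G x) (hi : IsIntegral x)
    (v : Fin n) : ∃ t ∈ Finset.Icc 1 n, x v t = 1 ∧ ∀ t' ∈ Finset.Icc 1 n, t' ≠ t → x v t' = 0 := by
  have h1 : ∃ t ∈ Finset.Icc 1 n, x v t = 1 := by
    by_contra! hc
    have := hx.sum_time v
    rw [Finset.sum_eq_zero (fun t ht => (hi v t ht).resolve_right (hc t ht))] at this
    exact zero_ne_one this
  obtain ⟨t, ht, h⟩ := h1
  refine ⟨t, ht, h, fun t' ht' hne => ?_⟩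
  have := hx.sum_time v
  rw [← Finset.add_sum_erase _ _ ht, h] at this
  have h0 : ∑ t ∈ (Finset.Icc 1 n).erase t, x v t = 0 := by linarith
  exact (Finset.sum_eq_zero_iff_of_nonneg
    (fun t ht => hx.nonneg v t (Finset.mem_of_mem_erase ht))).1 h0 t'
    (Finset.mem_erase.2 ⟨hne, ht'⟩)

theorem exists_earlier_neighbor {x : Fin n → ℕ → ℝ} (hx : SimpleLP G x) (hi : IsIntegral x)
    {v : Fin n} {t : ℕ} (ht : t ∈ Finset.Icc 1 n) (h1 : 1 < t) (hv : x v t = 1) :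
    ∃ w t', G.Adj v w ∧ 1 ≤ t' ∧ t' < t ∧ x w t' = 1 := by
  by_contra! hc
  have := hx.connectivity v t ht h1
  rw [Finset.sum_eq_zero, hv] at this
  · linarith
  · intro w _
    split_ifs with ha
    · refine Finset.sum_eq_zero fun t' ht' => ?_
      rw [Finset.mem_Ico] at ht'
      rw [Finset.mem_Icc] at ht
      exact (hi w t' (Finset.mem_Icc.2 ⟨ht'.1, by omega⟩)).resolve_right (hc w t' ha ht'.1 ht'.2)
    · rfl

theorem inflow_add_single {f : Fin n × ℕ → Fin n × ℕ → ℝ} {a b : Fin n × ℕ}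
    (ha : a ∈ flowNodes n) (q : Fin n × ℕ) :
    inflow (fun p r => f p r + if p = a ∧ r = b then 1 else 0) q =
      inflow f q + if q = b then 1 else 0 := by
  rw [inflow, Finset.sum_add_distrib, inflow]
  congr 1
  by_cases h : q = b <;> simp [h, ha]

theorem outflow_add_single {f : Fin n × ℕ → Fin n × ℕ → ℝ} {a b : Fin n × ℕ}
    (hb : b ∈ flowNodes n) (p : Fin n × ℕ) :
    outflow (fun p r => f p r + if p = a ∧ r = b then 1 else 0) p =
      outflow f p + if p = a then 1 else 0 := by
  rw [outflow, Finset.sum_add_distrib, outflow]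
  congr 1
  by_cases h : p = a <;> simp [h, hb]

/-- `f` is a unit flow from `X_{s,1}` to `d`, along nodes with `x = 1` and before `d`. -/
structure UnitFlow (G : SimpleGraph (Fin n)) (s : Fin n) (x : Fin n → ℕ → ℝ) (d : Fin n × ℕ)
    (f : Fin n × ℕ → Fin n × ℕ → ℝ) : Prop where
  nonneg : ∀ p q, 0 ≤ f p q
  support : ∀ p q, ¬ FlowEdge G p q → f p q = 0
  inflow_le : ∀ p ∈ flowNodes n, inflow f p ≤ x p.1 p.2
  outflow_le : ∀ p ∈ flowNodes n, outflow f p ≤ x p.1 p.2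
  inflow_late : ∀ p, d.2 < p.2 → inflow f p = 0
  outflow_late : ∀ p, d.2 ≤ p.2 → outflow f p = 0
  balance : ∀ p ∈ flowNodes n, p ≠ (s, 1) → inflow f p = outflow f p + if p = d then 1 else 0

theorem inflow_zero (q : Fin n × ℕ) : inflow (fun _ _ => (0 : ℝ)) q = 0 := by simp [inflow]

theorem outflow_zero (q : Fin n × ℕ) : outflow (fun _ _ => (0 : ℝ)) q = 0 := by simp [outflow]

/-- Strong induction on time: take a unit flow to an earlier active neighbour and append one edge.
The vanishing of late inflow and outflow keeps both ends of the new edge within capacity. -/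
theorem exists_unitFlow {s : Fin n} {x : Fin n → ℕ → ℝ} (hx : SimpleLP G x) (hi : IsIntegral x)
    (hs : x s 1 = 1) (t : ℕ) : ∀ v, t ∈ Finset.Icc 1 n → x v t = 1 →
      ∃ f, UnitFlow G s x (v, t) f := by
  induction t using Nat.strong_induction_on with
  | _ t ih =>
    intro v ht hv
    rcases (Finset.mem_Icc.1 ht).1.eq_or_lt with h1 | h1
    · subst h1
      -- At time `1` the total mass is `1` and `s` takes all of it; the zero flow then works, as the
      -- source is exempt from balance.
      have hvs : v = s := by
        by_contra hne
        have := hx.sum_node 1 ht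
        rw [← Finset.add_sum_erase _ _ (Finset.mem_univ s), hs] at this
        have h0 : ∑ w ∈ Finset.univ.erase s, x w 1 = 0 := by linarith
        rw [Finset.sum_eq_zero_iff_of_nonneg (fun w _ => hx.nonneg w 1 ht)] at h0
        rw [h0 v (by simp [hne])] at hv
        exact zero_ne_one hv
      subst hvs
      refine ⟨fun _ _ => 0, ⟨by simp, by simp, ?_, ?_, ?_, ?_, ?_⟩⟩
      · intro p hp
        rw [inflow_zero]
        exact hx.nonneg _ _ (Finset.mem_Icc.2 (mem_flowNodes.1 hp))
      · intro p hp
        rw [outflow_zero]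
        exact hx.nonneg _ _ (Finset.mem_Icc.2 (mem_flowNodes.1 hp))
      · simp [inflow_zero]
      · simp [outflow_zero]
      · intro p _ hne
        simp [inflow_zero, outflow_zero, hne]
    · obtain ⟨w, t', hadj, h1', hlt, hw⟩ := exists_earlier_neighbor hx hi ht h1 hv
      have htn := (Finset.mem_Icc.1 ht).2
      have ht' : t' ∈ Finset.Icc 1 n := Finset.mem_Icc.2 ⟨h1', by omega⟩
      obtain ⟨f, hf⟩ := ih t' hlt w ht' hw
      have ha : (w, t') ∈ flowNodes n := mem_flowNodes.2 (Finset.mem_Icc.1 ht')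
      have hb : (v, t) ∈ flowNodes n := mem_flowNodes.2 (Finset.mem_Icc.1 ht)
      refine ⟨fun p r => f p r + if p = (w, t') ∧ r = (v, t) then 1 else 0, ?_⟩
      constructor
      · intro p q
        have := hf.nonneg p q
        positivity
      · intro p q h
        rw [hf.support p q h, if_neg, add_zero]
        rintro ⟨rfl, rfl⟩
        exact h ⟨ha, hb, hadj.symm, hlt⟩
      · intro p hp
        rw [inflow_add_single ha]
        split_ifs with h
        · subst h
          rw [hf.inflow_late _ hlt, hv, zero_add]
        · rw [add_zero]
          exact hf.inflow_le p hp
      · intro p hp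
        rw [outflow_add_single hb]
        split_ifs with h
        · subst h
          rw [hf.outflow_late _ le_rfl, hw, zero_add]
        · rw [add_zero]
          exact hf.outflow_le p hp
      · intro p hp
        rw [inflow_add_single ha, hf.inflow_late p (hlt.trans hp), if_neg, add_zero]
        rintro rfl
        exact lt_irrefl _ hp
      · intro p hp
        rw [outflow_add_single hb, hf.outflow_late p (hlt.le.trans hp), if_neg, add_zero]
        rintro rfl
        exact absurd hlt (not_lt.2 hp)
      · intro p hp hne
        rw [inflow_add_single ha, outflow_add_single hb, hf.balance p hp hne]

/-- Only the activation time `τ` of `u` can carry demand: route one unit to `(u, τ)` if it is a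
sink, and nothing otherwise. Thresholds at least `2` keep the sinks apart from the source. -/
theorem SimpleLP.exists_solvesFlow {θ : Fin n → ℕ} (hθ : ∀ v, 2 ≤ θ v) {s : Fin n}
    {x : Fin n → ℕ → ℝ} (hx : SimpleLP G x) (hi : IsIntegral x) (hs : x s 1 = 1) (u : Fin n)
    {t : ℕ} (ht : t ≤ n) : ∃ f, SolvesFlow G θ s x u t f := by
  obtain ⟨τ, hτ, h1, h0⟩ := exists_activation_time hx hi u
  by_cases hin : θ u ≤ τ ∧ τ ≤ t
  · obtain ⟨f, hf⟩ := exists_unitFlow hx hi hs τ u hτ h1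
    refine ⟨f, hf.nonneg, hf.support, hf.inflow_le, hf.outflow_le, fun τ' h h' => ?_,
      fun p hp hne hsink => ?_⟩
    · have h2 := hθ u
      have hmem : τ' ∈ Finset.Icc 1 n := Finset.mem_Icc.2 ⟨by omega, by omega⟩
      rw [hf.balance (u, τ') (mem_flowNodes.2 (Finset.mem_Icc.1 hmem))
        (by simp only [ne_eq, Prod.mk.injEq, not_and]; omega)]
      by_cases he : τ' = τ
      · simp [he, h1]
      · simp [he, h0 τ' hmem he]
    · rw [hf.balance p hp hne, if_neg, add_zero]
      rintro rfl
      exact hsink ⟨rfl, hin⟩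
  · refine ⟨fun _ _ => 0, by simp, by simp, fun p hp => ?_, fun p hp => ?_, fun τ' h h' => ?_,
      fun p hp _ _ => ?_⟩
    · rw [inflow_zero]
      exact hx.nonneg _ _ (Finset.mem_Icc.2 (mem_flowNodes.1 hp))
    · rw [outflow_zero]
      exact hx.nonneg _ _ (Finset.mem_Icc.2 (mem_flowNodes.1 hp))
    · have h2 := hθ u
      rw [inflow_zero, outflow_zero, h0 τ' (Finset.mem_Icc.2 ⟨by omega, by omega⟩), sub_zero]
      rintro rfl
      exact hin ⟨h, h'⟩
    · rw [inflow_zero, outflow_zero]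

theorem augmentedIP_iff {θ : Fin n → ℕ} (hθ : ∀ v, 2 ≤ θ v) {s : Fin n} {x : Fin n → ℕ → ℝ} :
    AugmentedIP G θ s x ↔ SimpleIP G x ∧ x s 1 = 1 :=
  ⟨fun h => ⟨⟨h.1.simple, h.2⟩, h.1.source⟩, fun h => ⟨⟨h.1.1, h.2,
    fun u _ _ ht => h.1.1.exists_solvesFlow hθ h.1.2 h.2 u ht⟩, h.1.2⟩⟩

end IntegralFlow

/-! ### The cut between early and late vertices. -/

section Cut

variable {n : ℕ} {G : SimpleGraph (Fin n)} {θ : Fin n → ℕ} {S : Finset (Fin n)}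

/-- `q` leads to a sink of the `(u, t)`-flow problem through nodes past their thresholds. -/
inductive LateReach (G : SimpleGraph (Fin n)) (θ : Fin n → ℕ) (u : Fin n) (t : ℕ) :
    Fin n × ℕ → Prop
  | sink {τ : ℕ} (h1 : θ u ≤ τ) (h2 : τ ≤ t) : LateReach G θ u t (u, τ)
  | step {q r : Fin n × ℕ} (hq : θ q.1 ≤ q.2) (he : FlowEdge G q r) (hr : LateReach G θ u t r) :
      LateReach G θ u t q

theorem LateReach.threshold_le {u : Fin n} {t : ℕ} {q : Fin n × ℕ} (h : LateReach G θ u t q) :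
    θ q.1 ≤ q.2 := by
  cases h with
  | sink h1 _ => exact h1
  | step hq _ _ => exact hq

theorem flag_step {p q : Fin n × ℕ} (hq : θ q.1 ≤ q.2) (he : FlowEdge G p q)
    (hp : flag G θ S p.2 p) : flag G θ S q.2 q := by
  obtain ⟨v, τ⟩ := q
  have hlt : p.2 < τ := he.2.2.2
  cases τ with
  | zero => exact absurd hlt (Nat.not_lt_zero _)
  | succ k => exact Or.inr ⟨hq, le_rfl, p, he, flag_mono_iter (Nat.lt_succ_iff.1 hlt) hp⟩

theorem LateReach.flag {u : Fin n} {t : ℕ} {q : Fin n × ℕ} (h : LateReach G θ u t q)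
    (hq : flag G θ S q.2 q) : flag G θ S t (u, t) := by
  induction h with
  | sink h1 h2 => exact flag_mono_iter h2 (flag_mono_time h2 hq)
  | step _ he hr ih => exact ih (flag_step hr.threshold_le he hq)

/-- Net inflow of a set of nodes is at most the outflow of the nodes outside with an edge into
the set. -/
theorem sum_net_inflow_le {f : Fin n × ℕ → Fin n × ℕ → ℝ} (hf : ∀ p q, 0 ≤ f p q)
    {R B : Finset (Fin n × ℕ)} (hR : R ⊆ flowNodes n) (hB : B ⊆ flowNodes n)
    (hRB : ∀ p ∈ flowNodes n, p ∉ R → p ∉ B → ∀ q ∈ R, f p q = 0) :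
    ∑ q ∈ R, (inflow f q - outflow f q) ≤ ∑ p ∈ B, outflow f p := by
  have hin : ∑ q ∈ R, inflow f q ≤ ∑ q ∈ R, ∑ p ∈ R, f p q + ∑ q ∈ R, ∑ p ∈ B, f p q := by
    rw [← Finset.sum_add_distrib]
    refine Finset.sum_le_sum fun q hq => ?_
    have h1 : inflow f q = ∑ p ∈ R ∪ B, f p q := by
      refine (Finset.sum_subset (Finset.union_subset hR hB) fun p hp hn => ?_).symm
      rw [Finset.mem_union, not_or] at hn
      exact hRB p hp hn.1 hn.2 q hq
    rw [h1, ← Finset.sum_union_inter]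
    exact le_add_of_nonneg_right (Finset.sum_nonneg fun p _ => hf p q)
  have hout : ∑ q ∈ R, ∑ p ∈ R, f q p ≤ ∑ q ∈ R, outflow f q :=
    Finset.sum_le_sum fun q _ => Finset.sum_le_sum_of_subset_of_nonneg hR fun _ _ _ => hf _ _
  have hout' : ∑ p ∈ B, ∑ q ∈ R, f p q ≤ ∑ p ∈ B, outflow f p :=
    Finset.sum_le_sum fun q _ => Finset.sum_le_sum_of_subset_of_nonneg hR fun _ _ _ => hf _ _
  rw [Finset.sum_comm] at hout
  rw [Finset.sum_comm] at hout'
  rw [Finset.sum_sub_distrib]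
  linarith

theorem seedWeight_nonneg {x : Fin n → ℕ → ℝ} (hx : SimpleLP G x) (v : Fin n) :
    0 ≤ seedWeight θ x v :=
  Finset.sum_nonneg fun t ht => hx.nonneg v t (Finset.mem_filter.1 ht).1

/-- The nodes through which flow of the `(v, t)`-flow problem can last be early. -/
noncomputable def criticalNodes (G : SimpleGraph (Fin n)) (θ : Fin n → ℕ) (v : Fin n) (t : ℕ) :
    Finset (Fin n) :=
  open Classical in Finset.univ.filter fun w =>
    ∃ τ q, τ < θ w ∧ FlowEdge G (w, τ) q ∧ LateReach G θ v t q

/-- Seeds are flagged at every time, so the early vertex of `w` already passes its flag on. -/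
theorem flag_of_mem_criticalNodes {v w : Fin n} {t : ℕ} (hw : w ∈ criticalNodes G θ v t)
    (hS : w ∈ S) : flag G θ S t (v, t) := by
  classical
  simp only [criticalNodes, Finset.mem_filter, Finset.mem_univ, true_and] at hw
  obtain ⟨τ, q, -, he, hq⟩ := hw
  exact hq.flag (flag_step hq.threshold_le he (flag_of_mem _ hS))

/-- The net inflow of `R` is exactly the demand of the sinks, and it must enter through the early
vertices `B`, whose outflow is bounded by their capacities. -/
theorem sum_late_le {s : Fin n} {x : Fin n → ℕ → ℝ} (hθ : ∀ v, 2 ≤ θ v)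
    (hx : AugmentedLP G θ s x) (v : Fin n) {t : ℕ} (ht : t ≤ n) :
    ∑ τ ∈ (Finset.Icc 1 t).filter (fun τ => θ v ≤ τ), x v τ ≤
      ∑ w ∈ criticalNodes G θ v t, seedWeight θ x w := by
  classical
  by_cases hvt : θ v ≤ t
  swap
  · rw [Finset.sum_eq_zero]
    · exact Finset.sum_nonneg fun w _ => seedWeight_nonneg hx.simple w
    · intro τ hτ
      simp only [Finset.mem_filter, Finset.mem_Icc] at hτ
      omega
  obtain ⟨f, hf⟩ := hx.flow v t hvt ht
  set R := (flowNodes n).filter (LateReach G θ v t) with hR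
  set B := (flowNodes n).filter (fun p => p.2 < θ p.1 ∧ ∃ q, FlowEdge G p q ∧ LateReach G θ v t q)
    with hB
  have hcut := sum_net_inflow_le hf.nonneg (Finset.filter_subset _ _ : R ⊆ _)
    (Finset.filter_subset _ _ : B ⊆ _) (fun p hp hpR hpB q hq => by
      refine hf.support p q fun he => ?_
      have hq' := (Finset.mem_filter.1 hq).2
      -- A late vertex with an edge into `R` lies in `R` itself; an early one lies in `B`.
      rcases le_or_gt (θ p.1) p.2 with h | h
      · exact hpR (Finset.mem_filter.2 ⟨hp, .step h he hq'⟩)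
      · exact hpB (Finset.mem_filter.2 ⟨hp, h, q, he, hq'⟩))
  have hsinks : ∑ τ ∈ (Finset.Icc 1 t).filter (fun τ => θ v ≤ τ), x v τ =
      ∑ q ∈ R, (inflow f q - outflow f q) := by
    have himg : ((Finset.Icc 1 t).filter (fun τ => θ v ≤ τ)).image (fun τ => (v, τ)) ⊆ R := by
      intro q hq
      simp only [Finset.mem_image, Finset.mem_filter, Finset.mem_Icc] at hq
      obtain ⟨τ, ⟨⟨h1, h2⟩, h3⟩, rfl⟩ := hq
      exact Finset.mem_filter.2 ⟨mem_flowNodes.2 ⟨h1, h2.trans ht⟩, .sink h3 h2⟩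
    rw [← Finset.sum_subset himg, Finset.sum_image (fun a _ b _ h => (Prod.mk.inj h).2)]
    · refine Finset.sum_congr rfl fun τ hτ => ?_
      simp only [Finset.mem_filter, Finset.mem_Icc] at hτ
      exact (hf.demand τ hτ.2 hτ.1.2).symm
    · intro q hq hn
      rw [Finset.mem_filter] at hq
      rw [hf.conservation q hq.1, sub_self]
      -- The source is early because `2 ≤ θ s`, so it is not in `R`; otherwise its net outflow would
      -- spoil the count.
      · rintro rfl
        have h1 := hq.2.threshold_le
        have h2 := hθ s
        simp only at h1
        omega
      · rintro ⟨h1, h2, h3⟩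
        refine hn (Finset.mem_image.2 ⟨q.2, ?_, by rw [← h1]⟩)
        exact Finset.mem_filter.2 ⟨Finset.mem_Icc.2 ⟨(mem_flowNodes.1 hq.1).1, h3⟩, h2⟩
  have hBx : ∑ p ∈ B, outflow f p ≤ ∑ p ∈ B, x p.1 p.2 :=
    Finset.sum_le_sum fun p hp => hf.outflow_le p (Finset.mem_filter.1 hp).1
  have hBW : ∑ p ∈ B, x p.1 p.2 ≤ ∑ w ∈ criticalNodes G θ v t, seedWeight θ x w := by
    simp only [seedWeight]
    rw [Finset.sum_sigma']
    -- The seed weights sum over dependent pairs, so `B` is transported there before comparing index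
    -- sets.
    have hinj : Set.InjOn (fun p : Fin n × ℕ => (⟨p.1, p.2⟩ : (_ : Fin n) × ℕ)) B := by
      rintro ⟨a, b⟩ _ ⟨c, d⟩ _ h
      simpa using h
    rw [← Finset.sum_image (f := fun z : (_ : Fin n) × ℕ => x z.1 z.2) hinj]
    refine Finset.sum_le_sum_of_subset_of_nonneg ?_ ?_
    · intro z hz
      obtain ⟨p, hp, rfl⟩ := Finset.mem_image.1 hz
      obtain ⟨hp, hlt, q, he, hq⟩ := Finset.mem_filter.1 hp
      refine Finset.mem_sigma.2 ⟨?_, ?_⟩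
      · simp only [criticalNodes, Finset.mem_filter, Finset.mem_univ, true_and]
        exact ⟨p.2, q, hlt, he, hq⟩
      · exact Finset.mem_filter.2 ⟨Finset.mem_Icc.2 (mem_flowNodes.1 hp), hlt⟩
    · intro z hz _
      exact hx.simple.nonneg _ _ (Finset.mem_filter.1 (Finset.mem_sigma.1 hz).2).1
  rw [hsinks]
  exact hcut.trans (hBx.trans hBW)

theorem sum_early_le {x : Fin n → ℕ → ℝ} (hx : SimpleLP G x) (v : Fin n) {t : ℕ} (ht : t ≤ n) :
    ∑ τ ∈ (Finset.Icc 1 t).filter (fun τ => ¬ θ v ≤ τ), x v τ ≤ seedWeight θ x v := by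
  refine Finset.sum_le_sum_of_subset_of_nonneg (fun τ hτ => ?_)
    fun τ hτ _ => hx.nonneg v τ (Finset.mem_filter.1 hτ).1
  simp only [Finset.mem_filter, Finset.mem_Icc] at hτ ⊢
  omega

/-- A set of nodes of large total seed weight, each of which makes `v` active at `t` as a seed. -/
theorem exists_activating_set {s : Fin n} {x : Fin n → ℕ → ℝ} (hθ : ∀ v, 2 ≤ θ v)
    (hx : AugmentedLP G θ s x) (v : Fin n) {t : ℕ} (h1 : 1 ≤ t) (ht : t ≤ n) :
    ∃ W : Finset (Fin n), (∑ τ ∈ Finset.Icc 1 t, x v τ) / 2 ≤ ∑ w ∈ W, seedWeight θ x w ∧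
      ∀ w ∈ W, ∀ S, w ∈ S → getSeq G θ S v ≤ t := by
  classical
  refine ⟨insert v (criticalNodes G θ v t), ?_, ?_⟩
  · have hl := sum_late_le hθ hx v ht
    have he := sum_early_le (θ := θ) hx.simple v ht
    have h1 : ∑ w ∈ criticalNodes G θ v t, seedWeight θ x w ≤
        ∑ w ∈ insert v (criticalNodes G θ v t), seedWeight θ x w :=
      Finset.sum_le_sum_of_subset_of_nonneg (Finset.subset_insert _ _)
        fun w _ _ => seedWeight_nonneg hx.simple w
    have h2 : seedWeight θ x v ≤ ∑ w ∈ insert v (criticalNodes G θ v t), seedWeight θ x w :=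
      Finset.single_le_sum (f := seedWeight θ x) (fun w _ => seedWeight_nonneg hx.simple w)
        (Finset.mem_insert_self _ _)
    have h3 := Finset.sum_filter_add_sum_filter_not (Finset.Icc 1 t) (fun τ => θ v ≤ τ) (x v)
    linarith
  · intro w hw S hS
    rw [getSeq_le_iff h1 ht]
    rcases Finset.mem_insert.1 hw with rfl | hw
    · exact flag_of_mem n hS
    · exact flag_mono_iter ht (flag_of_mem_criticalNodes hw hS)

end Cut

/-! ### Random seeds: the chance of missing a given set. -/

section Sampling

open MeasureTheory ProbabilityTheory

variable {n : ℕ} {θ : Fin n → ℕ} {x : Fin n → ℕ → ℝ} {α : ℝ}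
  {Ω : Type*} [MeasurableSpace Ω] {μ : Measure Ω} [IsProbabilityMeasure μ]
  {S₀ : Ω → Finset (Fin n)}

omit [IsProbabilityMeasure μ] in
theorem IsSeedSample.measureReal (h : IsSeedSample θ x α μ S₀) {v : Fin n}
    (hα : 0 ≤ α * seedWeight θ x v) :
    μ.real {ω | v ∈ S₀ ω} = min 1 (α * seedWeight θ x v) := by
  rw [Measure.real, h.prob, ENNReal.toReal_ofReal (le_min zero_le_one hα)]

/-- By independence the probability is a product, and each factor `1 - min 1 a` is at most `exp
(-a)`. -/
theorem IsSeedSample.measureReal_disjoint_le (h : IsSeedSample θ x α μ S₀)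
    (hα : ∀ v, 0 ≤ α * seedWeight θ x v) (W : Finset (Fin n)) :
    μ.real {ω | ∀ w ∈ W, w ∉ S₀ ω} ≤ Real.exp (-(α * ∑ w ∈ W, seedWeight θ x w)) := by
  have hset : {ω | ∀ w ∈ W, w ∉ S₀ ω} = ⋂ w ∈ W, {ω | w ∈ S₀ ω}ᶜ := by
    ext ω; simp
  have hprod : μ (⋂ w ∈ W, {ω | w ∈ S₀ ω}ᶜ) = ∏ w ∈ W, μ {ω | w ∈ S₀ ω}ᶜ := by
    refine iIndep.meas_biInter h.indep fun w _ => ?_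
    -- Independence of sets is independence of the σ-algebras they generate, which contain the
    -- complements.
    exact (MeasurableSpace.measurableSet_generateFrom (Set.mem_singleton _)).compl
  rw [hset, Measure.real, hprod, ENNReal.toReal_prod, Finset.mul_sum, ← Finset.sum_neg_distrib,
    Real.exp_sum]
  refine Finset.prod_le_prod (fun _ _ => ENNReal.toReal_nonneg) fun w _ => ?_
  change μ.real _ ≤ _
  rw [probReal_compl_eq_one_sub (h.measurable w), h.measureReal (hα w)]
  rcases le_total 1 (α * seedWeight θ x w) with h1 | h1
  · rw [min_eq_left h1, sub_self]
    exact (Real.exp_pos _).le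
  · rw [min_eq_right h1]
    exact Real.one_sub_le_exp_neg _

/-- Only monotonicity of the measure is applied to `A`, so its measurability is not needed. -/
theorem IsSeedSample.le_measureReal (h : IsSeedSample θ x α μ S₀)
    (hα : ∀ v, 0 ≤ α * seedWeight θ x v) (W : Finset (Fin n)) {A : Set Ω}
    (hA : ∀ w ∈ W, ∀ ω, w ∈ S₀ ω → ω ∈ A) :
    1 - Real.exp (-(α * ∑ w ∈ W, seedWeight θ x w)) ≤ μ.real A := by
  have hm : MeasurableSet {ω | ∀ w ∈ W, w ∉ S₀ ω} := by
    have : {ω | ∀ w ∈ W, w ∉ S₀ ω} = ⋂ w ∈ W, {ω | w ∈ S₀ ω}ᶜ := by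
      ext ω; simp
    rw [this]
    exact Finset.measurableSet_biInter _ fun w _ => (h.measurable w).compl
  have hsub : {ω | ∀ w ∈ W, w ∉ S₀ ω}ᶜ ⊆ A := by
    intro ω hω
    simp only [Set.mem_compl_iff, Set.mem_ofPred_eq, not_forall, not_not] at hω
    obtain ⟨w, hw, hS⟩ := hω
    exact hA w hw ω hS
  have h1 := measureReal_mono (μ := μ) hsub
  rw [probReal_compl_eq_one_sub hm] at h1
  have := h.measureReal_disjoint_le hα W
  linarith

/-- Timestep `1` is early for `s`, so `s` has seed weight at least `1` and is sampled with
probability `1`. -/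
theorem IsSeedSample.ae_mem_source (h : IsSeedSample θ x α μ S₀) (hα : 1 ≤ α)
    (hθ : ∀ v, 2 ≤ θ v) {G : SimpleGraph (Fin n)} {s : Fin n} (hx : AugmentedLP G θ s x) :
    ∀ᵐ ω ∂μ, s ∈ S₀ ω := by
  have h1 : 1 ≤ seedWeight θ x s := by
    have hmem : 1 ∈ (Finset.Icc 1 n).filter (fun t => t < θ s) := by
      have := hθ s
      have := s.pos
      simp only [Finset.mem_filter, Finset.mem_Icc]
      omega
    rw [← hx.source]
    exact Finset.single_le_sum (f := x s)
      (fun t ht => hx.simple.nonneg s t (Finset.mem_filter.1 ht).1) hmem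
  have hm : MeasurableSet {ω | s ∈ S₀ ω} := h.measurable s
  change {ω | s ∈ S₀ ω} ∈ ae μ
  rw [mem_ae_iff_prob_eq_one hm, h.prob, min_eq_left (by nlinarith), ENNReal.ofReal_one]

end Sampling

/-! ### Numerical estimates for the sampling bias. -/

section Bounds

theorem one_le_log_four_mul {n : ℕ} {ε : ℝ} (hε : 0 < ε) (hn : ε ≤ (n : ℝ) ^ 2) :
    1 ≤ Real.log (4 * (n : ℝ) ^ 2 / ε) := by
  have h1 : (4 : ℝ) ≤ 4 * (n : ℝ) ^ 2 / ε := by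
    rw [le_div_iff₀ hε]; linarith
  rw [Real.le_log_iff_exp_le (by linarith)]
  linarith [Real.exp_one_lt_d9]

theorem one_le_samplingBias {n : ℕ} {ε : ℝ} (hε : 0 < ε) (hn : ε ≤ (n : ℝ) ^ 2) :
    1 ≤ samplingBias n ε := by
  have := one_le_log_four_mul hε hn
  rw [samplingBias]
  nlinarith

theorem exp_bound_of_large {n : ℕ} {ε y w : ℝ} (hε : 0 < ε) (hn : ε ≤ (n : ℝ) ^ 2)
    (hy : 1 / (12 * (1 + ε)) ≤ y) (hw : y / 2 ≤ w) :
    1 - ε / (4 * (n : ℝ) ^ 2) ≤ 1 - Real.exp (-(samplingBias n ε * w)) := by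
  have hL := one_le_log_four_mul hε hn
  have hb := one_le_samplingBias hε hn
  have hpos : 0 < 4 * (n : ℝ) ^ 2 / ε := div_pos (by linarith) hε
  have h1 : Real.log (4 * (n : ℝ) ^ 2 / ε) ≤ samplingBias n ε * w := by
    rw [div_le_iff₀ (by positivity)] at hy
    rw [samplingBias]
    -- The constant `24` is `12` doubled, to absorb the loss of half the mass in `hw`.
    have : 1 ≤ 24 * (1 + ε) * w := by nlinarith
    nlinarith
  have h2 : Real.exp (-(samplingBias n ε * w)) ≤ ε / (4 * (n : ℝ) ^ 2) := by
    calc Real.exp (-(samplingBias n ε * w))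
        ≤ Real.exp (-Real.log (4 * (n : ℝ) ^ 2 / ε)) := Real.exp_le_exp.2 (by linarith)
      _ = ε / (4 * (n : ℝ) ^ 2) := by rw [Real.exp_neg, Real.exp_log hpos, inv_div]
  linarith

theorem exp_bound_of_small {n : ℕ} {ε y w : ℝ} (hε : 0 < ε) (hn : ε ≤ (n : ℝ) ^ 2) (hy0 : 0 ≤ y)
    (hy : y < 1 / (12 * (1 + ε))) (hw : y / 2 ≤ w) :
    (1 + ε) * y ≤ 1 - Real.exp (-(samplingBias n ε * w)) := by
  have hL := one_le_log_four_mul hε hn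
  rw [lt_div_iff₀ (by positivity)] at hy
  set z := 12 * (1 + ε) * y with hz
  have hz0 : 0 ≤ z := by positivity
  have h1 : z ≤ samplingBias n ε * w := by
    have h2 : z ≤ 24 * (1 + ε) * w := by rw [hz]; nlinarith
    rw [samplingBias]
    nlinarith
  have h2 : Real.exp (-(samplingBias n ε * w)) ≤ 1 / (1 + z) := by
    calc Real.exp (-(samplingBias n ε * w)) ≤ Real.exp (-z) := Real.exp_le_exp.2 (by linarith)
      _ = 1 / Real.exp z := by rw [Real.exp_neg, one_div]
      _ ≤ 1 / (1 + z) := by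
        apply one_div_le_one_div_of_le (by linarith)
        linarith [Real.add_one_le_exp z]
  -- After clearing denominators this is `0 ≤ z * (11 - z)`, and here `0 ≤ z < 1`.
  have h3 : 1 / (1 + z) ≤ 1 - z / 12 := by
    rw [div_le_iff₀ (by linarith)]
    nlinarith
  have h4 : (1 + ε) * y = z / 12 := by rw [hz]; ring
  linarith

end Bounds

/-! ### A polynomial-time program for Get-Seq. -/

section Program

/-- The number of passes is fixed on entry. Each pass costs its body plus one step, and entering the
loop costs one more. -/
theorem Prog.run_loop_invariant (r : ℕ) (p : Prog) (c : ℕ) (I : ℕ → Memory → Prop) (m : Memory)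
    (h0 : I 0 m)
    (hstep : ∀ i < m.reg r, ∀ m', I i m' → I (i + 1) (p.run m').1 ∧ (p.run m').2 ≤ c) :
    I (m.reg r) ((Prog.loop r p).run m).1 ∧
      ((Prog.loop r p).run m).2 ≤ 1 + m.reg r * (c + 1) := by
  have key : ∀ k ≤ m.reg r,
      I k ((fun c : Memory × ℕ => ((p.run c.1).1, c.2 + (p.run c.1).2 + 1))^[k] (m, 1)).1 ∧
      ((fun c : Memory × ℕ => ((p.run c.1).1, c.2 + (p.run c.1).2 + 1))^[k] (m, 1)).2
        ≤ 1 + k * (c + 1) := by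
    intro k
    induction k with
    | zero => exact fun _ => ⟨h0, by simp⟩
    | succ k ih =>
      intro hk
      obtain ⟨h1, h2⟩ := ih (by omega)
      obtain ⟨h3, h4⟩ := hstep k (by omega) _ h1
      rw [Function.iterate_succ_apply']
      refine ⟨h3, ?_⟩
      simp only
      rw [add_mul]
      omega
  exact key _ le_rfl

/-- Copy the indicator of the seeds into the output: seeds have activation time `1`. -/
def initBody : Prog :=
  .seq (.load 5 2 2 4) (.seq (.store 3 2 4 5) (.succ 2))

/-- With the time in register `1`, node `u` in register `2` and node `v` in register `3`: activate
`u` if it is inactive, past its threshold, and `v` is a neighbour which has been activated. -/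
def relaxBody : Prog :=
  .seq (.load 5 0 3 2) (.seq (.load 6 3 3 4) (.seq (.load 7 3 2 4) (.seq (.load 8 1 2 4)
    (.seq (.ifLt 4 5 (.ifLt 4 6 (.ifLt 6 1 (.ifLt 4 7 (.zero 4) (.ifLt 1 8 (.zero 4)
      (.store 3 2 4 1))) (.zero 4)) (.zero 4)) (.zero 4)) (.succ 3)))))

/-- Pass through all `v` for a fixed `u`. -/
def nodeBody : Prog :=
  .seq (.zero 3) (.seq (.loop 0 relaxBody) (.succ 2))

/-- One timestep. -/
def timeBody : Prog :=
  .seq (.succ 1) (.seq (.zero 2) (.loop 0 nodeBody))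

/-- The program for `Get-Seq`. -/
def getSeqProg : Prog :=
  .seq (.loop 0 initBody) (.loop 0 timeBody)

variable {n : ℕ} {G : SimpleGraph (Fin n)} {θ : Fin n → ℕ} {S : Finset (Fin n)}

/-- The memory cells which the program never changes. -/
structure HoldsInput (G : SimpleGraph (Fin n)) (θ : Fin n → ℕ) (S : Finset (Fin n))
    (m : Memory) : Prop where
  size : m.reg 0 = n
  zero : m.reg 4 = 0
  adj : ∀ u v : Fin n, 0 < m.arr 0 u v ↔ G.Adj u v
  thr : ∀ u : Fin n, m.arr 1 u 0 = θ u
  seed : ∀ u : Fin n, m.arr 2 u 0 = open Classical in if u ∈ S then 1 else 0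

theorem holdsInput_encodeInput : HoldsInput G θ S (encodeInput G θ S) where
  size := by simp [encodeInput]
  zero := by simp [encodeInput]
  adj u v := by
    simp only [encodeInput, if_true]
    split_ifs with h
    · obtain ⟨u', v', hu, hv, h⟩ := h
      rw [Fin.val_inj] at hu hv
      subst hu hv
      simpa using h
    · simp only [lt_irrefl, false_iff]
      exact fun ha => h ⟨u, v, rfl, rfl, ha⟩
  thr u := by simp [encodeInput]
  seed u := by
    simp only [encodeInput]
    norm_num
    congr 1
    simp only [eq_iff_iff]
    constructor
    · rintro ⟨u', h, he⟩
      rwa [← Fin.val_inj.1 he]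
    · exact fun h => ⟨u, h, rfl⟩

theorem HoldsInput.congr {m m' : Memory} (h : HoldsInput G θ S m) (h0 : m'.reg 0 = m.reg 0)
    (h4 : m'.reg 4 = m.reg 4) (ha : ∀ a, a ≠ 3 → m'.arr a = m.arr a) : HoldsInput G θ S m' where
  size := h0.trans h.size
  zero := h4.trans h.zero
  adj u v := by rw [ha 0 (by norm_num)]; exact h.adj u v
  thr u := by rw [ha 1 (by norm_num)]; exact h.thr u
  seed u := by rw [ha 2 (by norm_num)]; exact h.seed u

theorem run_initBody (m : Memory) (h4 : m.reg 4 = 0) :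
    (initBody.run m).1.reg 0 = m.reg 0 ∧ (initBody.run m).1.reg 1 = m.reg 1 ∧
    (initBody.run m).1.reg 2 = m.reg 2 + 1 ∧
    (initBody.run m).1.reg 4 = m.reg 4 ∧
    (∀ a, a ≠ 3 → (initBody.run m).1.arr a = m.arr a) ∧
    (∀ w, (initBody.run m).1.arr 3 w 0 =
      if w = m.reg 2 then m.arr 2 (m.reg 2) 0 else m.arr 3 w 0) ∧
    (initBody.run m).2 ≤ 3 := by
  refine ⟨?_, ?_, ?_, ?_, ?_, ?_, ?_⟩ <;>
    simp [initBody, Prog.run, Memory.setReg, Memory.setArr, h4, Function.update_apply]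
  · intro a ha
    simp [ha]
  · intro w
    split_ifs <;> simp

-- Register `4` is the constant `0`, so `.zero 4` acts as a no-op in the failing branches. The bound
-- counts four loads, at most five tests, one leaf and the final increment.
open Classical in
theorem run_relaxBody (m : Memory) (h4 : m.reg 4 = 0) :
    (relaxBody.run m).1.reg 0 = m.reg 0 ∧ (relaxBody.run m).1.reg 1 = m.reg 1 ∧
    (relaxBody.run m).1.reg 2 = m.reg 2 ∧ (relaxBody.run m).1.reg 3 = m.reg 3 + 1 ∧
    (relaxBody.run m).1.reg 4 = m.reg 4 ∧
    (∀ a, a ≠ 3 → (relaxBody.run m).1.arr a = m.arr a) ∧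
    (∀ w, (relaxBody.run m).1.arr 3 w 0 =
      if w = m.reg 2 ∧ 0 < m.arr 0 (m.reg 3) (m.reg 2) ∧ 0 < m.arr 3 (m.reg 3) 0 ∧
        m.arr 3 (m.reg 3) 0 < m.reg 1 ∧ m.arr 3 (m.reg 2) 0 = 0 ∧ m.arr 1 (m.reg 2) 0 ≤ m.reg 1
      then m.reg 1 else m.arr 3 w 0) ∧
    (relaxBody.run m).2 ≤ 11 := by
  have hz : ∀ {a : ℕ}, ¬ 0 < a → a = 0 := fun h => by omega
  by_cases c1 : 0 < m.arr 0 (m.reg 3) (m.reg 2)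
  swap
  · simp [relaxBody, Prog.run, Memory.setReg, h4, hz c1]
  by_cases c2 : 0 < m.arr 3 (m.reg 3) 0
  swap
  · simp [relaxBody, Prog.run, Memory.setReg, h4, c1, hz c2]
  by_cases c3 : m.arr 3 (m.reg 3) 0 < m.reg 1
  swap
  · simp [relaxBody, Prog.run, Memory.setReg, h4, c1, c2, c3]
  by_cases c4 : 0 < m.arr 3 (m.reg 2) 0
  · simp [relaxBody, Prog.run, Memory.setReg, h4, c1, c2, c3, c4, c4.ne']
  by_cases c5 : m.reg 1 < m.arr 1 (m.reg 2) 0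
  · simp [relaxBody, Prog.run, Memory.setReg, h4, c1, c2, c3, hz c4, c5, c5.not_ge]
  · simp [relaxBody, Prog.run, Memory.setReg, Memory.setArr, h4, Function.update_apply, c1, c2, c3,
      hz c4, c5, not_lt.1 c5]
    constructor
    · intro a ha
      simp [ha]
    · intro w
      split_ifs <;> simp

/-- The activation time of `u` after the relaxation of the edges from the nodes below `b` at time
`t`, given the activation times `a` (`0` if inactive). -/
noncomputable def relaxed (G : SimpleGraph (Fin n)) (θ : Fin n → ℕ) (a : Fin n → ℕ) (t b : ℕ)
    (u : Fin n) : ℕ :=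
  open Classical in
    if a u = 0 ∧ θ u ≤ t ∧ ∃ v : Fin n, v.val < b ∧ G.Adj v u ∧ 0 < a v ∧ a v < t then t else a u

theorem relaxed_zero (a : Fin n → ℕ) (t : ℕ) (u : Fin n) : relaxed G θ a t 0 u = a u := by
  simp [relaxed]

/-- This makes in-place updates sound: values written during timestep `t` equal `t`, and the strict
test against `t` does not see them. -/
theorem relaxed_active_iff (a : Fin n → ℕ) (t b : ℕ) (u : Fin n) :
    (0 < relaxed G θ a t b u ∧ relaxed G θ a t b u < t) ↔ 0 < a u ∧ a u < t := by
  unfold relaxed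
  split_ifs with h
  · simp [h.1]
  · rfl

open Classical in
theorem relaxed_succ (a : Fin n → ℕ) (t : ℕ) (u v : Fin n) :
    relaxed G θ a t (v + 1) u =
      if G.Adj v u ∧ 0 < a v ∧ a v < t ∧ relaxed G θ a t v u = 0 ∧ θ u ≤ t then t
      else relaxed G θ a t v u := by
  have hex : (∃ w : Fin n, w.val < v.val + 1 ∧ G.Adj w u ∧ 0 < a w ∧ a w < t) ↔
      (∃ w : Fin n, w.val < v.val ∧ G.Adj w u ∧ 0 < a w ∧ a w < t) ∨
      (G.Adj v u ∧ 0 < a v ∧ a v < t) := by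
    constructor
    · rintro ⟨w, hw, h⟩
      rcases Nat.lt_succ_iff_lt_or_eq.1 hw with hw | hw
      · exact Or.inl ⟨w, hw, h⟩
      · rw [Fin.val_inj] at hw
        exact Or.inr (hw ▸ h)
    · rintro (⟨w, hw, h⟩ | h)
      · exact ⟨w, by omega, h⟩
      · exact ⟨v, by omega, h⟩
  unfold relaxed
  simp only [hex]
  by_cases h : a u = 0 ∧ θ u ≤ t ∧ ∃ w : Fin n, w.val < v.val ∧ G.Adj w u ∧ 0 < a w ∧ a w < t
  · rw [if_pos h, if_pos ⟨h.1, h.2.1, Or.inl h.2.2⟩, ite_self]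
  · simp only [if_neg h]
    refine if_congr ⟨?_, fun ⟨h3, h4, h5, h6, h7⟩ => ⟨h6, h7, Or.inr ⟨h3, h4, h5⟩⟩⟩ rfl rfl
    rintro ⟨h1, h2, h3 | ⟨h3, h4, h5⟩⟩
    · exact absurd ⟨h1, h2, h3⟩ h
    · exact ⟨h3, h4, h5, h1, h2⟩

/-- `a` represents the flags after `k` passes of `Get-Seq`. -/
def RepresentsFlags (G : SimpleGraph (Fin n)) (θ : Fin n → ℕ) (S : Finset (Fin n)) (k : ℕ)
    (a : Fin n → ℕ) : Prop :=
  ∀ u, a u ≤ max 1 k ∧ ∀ t, 1 ≤ t → (flag G θ S k (u, t) ↔ 0 < a u ∧ a u ≤ t)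

/-- An edge from a flagged vertex exists exactly when some neighbour has activation time below `k +
1`. The bound is `max 1 k` because seeds carry time `1` even before the first pass. -/
theorem RepresentsFlags.succ {k : ℕ} (hk : k + 1 ≤ n) {a : Fin n → ℕ}
    (ha : RepresentsFlags G θ S k a) :
    RepresentsFlags G θ S (k + 1) (relaxed G θ a (k + 1) n) := by
  intro u
  have hex : (∃ q, FlowEdge G q (u, k + 1) ∧ flag G θ S k q) ↔
      ∃ v : Fin n, v.val < n ∧ G.Adj v u ∧ 0 < a v ∧ a v < k + 1 := by
    constructor
    · rintro ⟨⟨v, τ⟩, ⟨hq, -, hadj, hlt⟩, hf⟩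
      simp only [flowNodes, Finset.mem_product, Finset.mem_Icc] at hq
      have := ((ha v).2 τ hq.2.1).1 hf
      exact ⟨v, v.2, hadj, this.1, this.2.trans_lt hlt⟩
    · rintro ⟨v, -, hadj, h1, h2⟩
      -- The activation time itself is the earliest flagged time of `v`.
      refine ⟨(v, a v), ⟨?_, ?_, hadj, h2⟩, ((ha v).2 _ h1).2 ⟨h1, le_rfl⟩⟩
      · simp only [flowNodes, Finset.mem_product, Finset.mem_univ, Finset.mem_Icc, true_and]
        omega
      · simp only [flowNodes, Finset.mem_product, Finset.mem_univ, Finset.mem_Icc, true_and]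
        omega
  have hstep : ∀ t, flag G θ S (k + 1) (u, t) ↔ flag G θ S k (u, t) ∨ (θ u ≤ k + 1 ∧ k + 1 ≤ t ∧
      ∃ q, FlowEdge G q (u, k + 1) ∧ flag G θ S k q) := fun _ => Iff.rfl
  have hle := (ha u).1
  constructor
  · unfold relaxed
    split_ifs <;> omega
  intro t ht
  rw [hstep, (ha u).2 t ht, hex]
  unfold relaxed
  split_ifs with h
  · obtain ⟨h0, h1, h2⟩ := h
    constructor
    · rintro (h | h) <;> omega
    · exact fun h => Or.inr ⟨h1, h.2, h2⟩
  · constructor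
    · rintro (h' | ⟨h1, h2, h3⟩)
      · exact h'
      · have : a u ≠ 0 := fun h0 => h ⟨h0, h1, h3⟩
        omega
    · exact Or.inl

/-- The output array, as a function of the nodes. -/
def Memory.times (m : Memory) (u : Fin n) : ℕ := m.arr 3 u 0

/-- The invariant records progress: nodes before `u` have seen all neighbours, `u` those below the
counter, and later nodes none, all relative to the times `a` at the start of the timestep. -/
theorem run_loop_relaxBody {m : Memory} (hm : HoldsInput G θ S m) (a : Fin n → ℕ) {t : ℕ}
    (h1 : m.reg 1 = t) (u : Fin n) (h2 : m.reg 2 = u) (h3 : m.reg 3 = 0)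
    (ha : ∀ w : Fin n, m.times w = relaxed G θ a t (if w < u then n else 0) w) :
    (HoldsInput G θ S ((Prog.loop 0 relaxBody).run m).1 ∧
      ((Prog.loop 0 relaxBody).run m).1.reg 1 = t ∧
      ((Prog.loop 0 relaxBody).run m).1.reg 2 = u ∧
      ∀ w : Fin n, ((Prog.loop 0 relaxBody).run m).1.times w =
        relaxed G θ a t (if w < u then n else if w = u then n else 0) w) ∧
    ((Prog.loop 0 relaxBody).run m).2 ≤ 1 + n * 12 := by
  have key := Prog.run_loop_invariant 0 relaxBody 11 (fun j m => HoldsInput G θ S m ∧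
    m.reg 1 = t ∧ m.reg 2 = u ∧ m.reg 3 = j ∧ ∀ w : Fin n, m.times w =
      relaxed G θ a t (if w < u then n else if w = u then j else 0) w) m
    ⟨hm, h1, h2, h3, by simpa using ha⟩ ?_
  · rw [hm.size] at key
    obtain ⟨⟨k1, k2, k3, -, k4⟩, k5⟩ := key
    exact ⟨⟨k1, k2, k3, k4⟩, k5⟩
  · rintro j hj m' ⟨i1, i2, i3, i4, i5⟩
    rw [hm.size] at hj
    obtain ⟨r0, r1, r2, r3, r4, r5, r6, r7⟩ := run_relaxBody m' i1.zero
    refine ⟨⟨i1.congr r0 r4 r5, r1.trans i2, r2.trans i3, by omega, fun w => ?_⟩, r7⟩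
    have hw := i5 w
    have hu := i5 u
    have hv := i5 ⟨j, hj⟩
    have hadj := i1.adj ⟨j, hj⟩ u
    have hthr := i1.thr u
    simp only [Memory.times] at hw hu hv hadj ⊢
    rw [r6, i2, i3, i4]
    by_cases hwu : w = u
    · subst hwu
      simp only [lt_irrefl, if_false, if_true] at hw ⊢
      classical
      have hs := relaxed_succ (G := G) (θ := θ) a t w ⟨j, hj⟩
      -- The program reads the current entry of the neighbour, which may already be updated; the
      -- test has the same outcome as for `a`.
      have hact := relaxed_active_iff (G := G) (θ := θ) a t
        (if (⟨j, hj⟩ : Fin n) < w then n else if (⟨j, hj⟩ : Fin n) = w then j else 0) ⟨j, hj⟩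
      rw [← hv] at hact
      rw [hs]
      refine if_congr ?_ rfl hw
      rw [hadj, hthr, hw]
      tauto
    · rw [if_neg (fun h => hwu (Fin.ext h.1)), hw]
      simp [hwu]

theorem run_nodeBody {m : Memory} (hm : HoldsInput G θ S m) (a : Fin n → ℕ) {t : ℕ}
    (h1 : m.reg 1 = t) {i : ℕ} (hi : i < n) (h2 : m.reg 2 = i)
    (ha : ∀ w : Fin n, m.times w = relaxed G θ a t (if w < i then n else 0) w) :
    (HoldsInput G θ S (nodeBody.run m).1 ∧ (nodeBody.run m).1.reg 1 = t ∧
      (nodeBody.run m).1.reg 2 = i + 1 ∧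
      ∀ w : Fin n, (nodeBody.run m).1.times w =
        relaxed G θ a t (if w < i + 1 then n else 0) w) ∧
    (nodeBody.run m).2 ≤ 3 + n * 12 := by
  obtain ⟨⟨k1, k2, k3, k4⟩, k5⟩ := run_loop_relaxBody (m := m.setReg 3 0)
    (hm.congr (by simp [Memory.setReg]) (by simp [Memory.setReg]) (fun _ _ => rfl)) a
    (by simpa [Memory.setReg] using h1) ⟨i, hi⟩ (by simpa [Memory.setReg] using h2)
    (by simp [Memory.setReg]) ha
  generalize hM : (Prog.loop 0 relaxBody).run (m.setReg 3 0) = M at k1 k2 k3 k4 k5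
  have hrun : nodeBody.run m = (M.1.setReg 2 (M.1.reg 2 + 1), 1 + (M.2 + 1)) := by
    simp only [nodeBody, Prog.run] at hM ⊢
    rw [hM]
  rw [hrun]
  refine ⟨⟨k1.congr (by simp [Memory.setReg]) (by simp [Memory.setReg]) (fun _ _ => rfl),
    by simpa [Memory.setReg] using k2, by simp [Memory.setReg, k3], fun w => ?_⟩, by simp; omega⟩
  refine (k4 w).trans ?_
  congr 1
  simp only [Fin.lt_def, Fin.ext_iff]
  split_ifs <;> omega

theorem run_timeBody {m : Memory} (hm : HoldsInput G θ S m) {k : ℕ} (hk : k < n)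
    (h1 : m.reg 1 = k) (ha : RepresentsFlags G θ S k m.times) :
    (HoldsInput G θ S (timeBody.run m).1 ∧ (timeBody.run m).1.reg 1 = k + 1 ∧
      RepresentsFlags G θ S (k + 1) (timeBody.run m).1.times) ∧
    (timeBody.run m).2 ≤ 3 + n * (n * 12 + 4) := by
  set m₁ : Memory := (m.setReg 1 (m.reg 1 + 1)).setReg 2 0 with hm₁
  have hb : HoldsInput G θ S m₁ :=
    hm.congr (by simp [hm₁, Memory.setReg]) (by simp [hm₁, Memory.setReg]) (fun _ _ => rfl)
  have key := Prog.run_loop_invariant 0 nodeBody (3 + n * 12) (fun i m' => HoldsInput G θ S m' ∧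
    m'.reg 1 = k + 1 ∧ m'.reg 2 = i ∧ ∀ w : Fin n, m'.times w =
      relaxed G θ m.times (k + 1) (if w < i then n else 0) w) m₁
    ⟨hb, by simp [hm₁, Memory.setReg, h1], by simp [hm₁, Memory.setReg],
      fun w => by simp only [not_lt_zero, if_false, relaxed_zero]; rfl⟩ ?_
  · rw [hb.size] at key
    obtain ⟨⟨k1, k2, -, k4⟩, k5⟩ := key
    generalize hM : (Prog.loop 0 nodeBody).run m₁ = M at k1 k2 k4 k5
    have hrun : timeBody.run m = (M.1, 1 + (1 + M.2)) := by
      simp only [timeBody, Prog.run, hm₁] at hM ⊢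
      rw [hM]
    rw [hrun]
    refine ⟨⟨k1, k2, ?_⟩, ?_⟩
    · have : (M.1.times : Fin n → ℕ) = relaxed G θ m.times (k + 1) n := by
        ext w; rw [k4 w, if_pos w.2]
      rw [this]
      exact ha.succ hk
    · simp only
      have : n * (3 + n * 12 + 1) = n * (n * 12 + 4) := by ring
      omega
  · rintro i hi m' ⟨i1, i2, i3, i4⟩
    rw [hb.size] at hi
    obtain ⟨⟨k1, k2, k3, k4⟩, k5⟩ := run_nodeBody i1 m.times i2 hi i3 i4
    exact ⟨⟨k1, k2, k3, k4⟩, k5⟩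

theorem run_loop_initBody {m : Memory} (hm : HoldsInput G θ S m) (h1 : m.reg 1 = 0)
    (h2 : m.reg 2 = 0) :
    (HoldsInput G θ S ((Prog.loop 0 initBody).run m).1 ∧
      ((Prog.loop 0 initBody).run m).1.reg 1 = 0 ∧
      RepresentsFlags G θ S 0 ((Prog.loop 0 initBody).run m).1.times) ∧
    ((Prog.loop 0 initBody).run m).2 ≤ 1 + n * 4 := by
  classical
  have key := Prog.run_loop_invariant 0 initBody 3 (fun i m => HoldsInput G θ S m ∧
    m.reg 1 = 0 ∧ m.reg 2 = i ∧ ∀ w : Fin n, w < i → m.times w = if w ∈ S then 1 else 0) m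
    ⟨hm, h1, h2, by simp⟩ ?_
  · rw [hm.size] at key
    obtain ⟨⟨k1, k2, -, k4⟩, k5⟩ := key
    refine ⟨⟨k1, k2, fun u => ?_⟩, k5⟩
    rw [k4 u u.2]
    refine ⟨by split_ifs <;> simp, fun t ht => ?_⟩
    change u ∈ S ↔ _
    split_ifs with h <;> simp [h, ht]
  · rintro i hi m' ⟨i1, i2, i3, i4⟩
    rw [hm.size] at hi
    obtain ⟨r0, r1, r2, r3, r4, r5, r6⟩ := run_initBody m' i1.zero
    refine ⟨⟨i1.congr r0 r3 r4, r1.trans i2, by omega, fun w hw => ?_⟩, r6⟩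
    have hs := i1.seed w
    rw [Memory.times, r5, i3]
    split_ifs with h h' h'
    · rw [← h, hs, if_pos h']
    · rw [← h, hs, if_neg h']
    · exact (i4 w (by omega)).trans (if_pos h')
    · exact (i4 w (by omega)).trans (if_neg h')

theorem RepresentsFlags.holdsOutput {m : Memory} (h : RepresentsFlags G θ S n m.times) :
    HoldsOutput m (getSeq G θ S) := by
  intro u
  obtain ⟨hle, hf⟩ := h u
  have hn : 0 < n := u.pos
  change (_ ∧ m.times u = 0) ∨ (_ = (m.times u : ℕ∞) ∧ 1 ≤ m.times u)
  by_cases h0 : m.times u = 0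
  · left
    refine ⟨?_, h0⟩
    rcases getSeq_eq_top_or (G := G) (θ := θ) (S := S) u with h | ⟨t, ht, htn, h⟩
    · exact h
    · have := (hf t ht).1 ((getSeq_le_iff ht htn u).1 h.le)
      omega
  · right
    have h1 : 1 ≤ m.times u := by omega
    refine ⟨le_antisymm ?_ ?_, h1⟩
    · exact (getSeq_le_iff h1 (by omega) u).2 ((hf _ h1).2 ⟨h1, le_rfl⟩)
    · rcases getSeq_eq_top_or (G := G) (θ := θ) (S := S) u with h | ⟨t, ht, htn, h⟩
      · simp [h]
      · rw [h]
        exact_mod_cast ((hf t ht).1 ((getSeq_le_iff ht htn u).1 h.le)).2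

theorem efficientlyComputable_getSeq :
    EfficientlyComputable (fun _ G θ S => getSeq G θ S) := by
  -- The sum of the bounds `1 + n * 4` for initialization and `1 + n * (3 + n * (n * 12 + 4) + 1)`
  -- for the timesteps.
  refine ⟨getSeqProg, 2 + Polynomial.X * 4 + Polynomial.X * (4 + Polynomial.X *
    (Polynomial.X * 12 + 4)), fun n G θ S => ?_⟩
  obtain ⟨⟨k1, k2, k3⟩, k4⟩ := run_loop_initBody (holdsInput_encodeInput (G := G) (θ := θ) (S := S))
    (by simp [encodeInput]) (by simp [encodeInput])
  have hrun : getSeqProg.run (encodeInput G θ S) =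
      (((Prog.loop 0 timeBody).run ((Prog.loop 0 initBody).run (encodeInput G θ S)).1).1,
        ((Prog.loop 0 initBody).run (encodeInput G θ S)).2 +
        ((Prog.loop 0 timeBody).run ((Prog.loop 0 initBody).run (encodeInput G θ S)).1).2) := by
    rw [getSeqProg, Prog.run]
  rw [hrun]
  generalize (Prog.loop 0 initBody).run (encodeInput G θ S) = M at k1 k2 k3 k4
  have key := Prog.run_loop_invariant 0 timeBody (3 + n * (n * 12 + 4)) (fun k m =>
    HoldsInput G θ S m ∧ m.reg 1 = k ∧ RepresentsFlags G θ S k m.times) M.1 ⟨k1, k2, k3⟩ ?_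
  · rw [k1.size] at key
    obtain ⟨⟨-, -, h3⟩, h4⟩ := key
    refine ⟨?_, h3.holdsOutput⟩
    simp only [Polynomial.eval_add, Polynomial.eval_mul, Polynomial.eval_X,
      Polynomial.eval_ofNat]
    have : n * (3 + n * (n * 12 + 4) + 1) = n * (4 + n * (n * 12 + 4)) := by ring
    omega
  · rintro k hk m' ⟨i1, i2, i3⟩
    rw [k1.size] at hk
    exact run_timeBody i1 hk i2 i3

end Program

end TechDiffusion

/-! ### The proposition. -/

theorem proposition3p1 :
    TechDiffusion.EfficientlyComputable (fun _ G θ S => TechDiffusion.getSeq G θ S) ∧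
    ∀ (n : ℕ) (G : SimpleGraph (Fin n)) (_ : G.Connected)
      (θ : Fin n → ℕ) (_ : ∀ v, 2 ≤ θ v ∧ θ v ≤ n) (s : Fin n),
      -- the augmented program is the simple program restricted to `x s 1 = 1`
      (∀ x : Fin n → ℕ → ℝ, TechDiffusion.AugmentedIP G θ s x ↔
        TechDiffusion.SimpleIP G x ∧ x s 1 = 1) ∧
      -- `Glue` makes finitely many passes, and always returns a set
      (WellFounded (fun S' S : Finset (Fin n) => TechDiffusion.GlueStep G S S') ∧
        ∀ S, ∃ S', TechDiffusion.GlueReturns G S S') ∧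
      ∀ (ε : ℝ) (_ : 0 < ε) (_ : ε ≤ (n : ℝ) ^ 2)
        (x : Fin n → ℕ → ℝ) (_ : TechDiffusion.AugmentedLP G θ s x)
        (glue : Finset (Fin n) → Finset (Fin n))
        (_ : ∀ S, TechDiffusion.GlueReturns G S (glue S))
        {Ω : Type*} [MeasurableSpace Ω] (μ : MeasureTheory.Measure Ω)
        [MeasureTheory.IsProbabilityMeasure μ] (S₀ : Ω → Finset (Fin n))
        (_ : TechDiffusion.IsSeedSample θ x (TechDiffusion.samplingBias n ε) μ S₀)
        (S : Ω → Finset (Fin n)) (_ : ∀ ω, S ω = glue (S₀ ω))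
        (T : Ω → Fin n → ℕ∞) (_ : ∀ ω, T ω = TechDiffusion.getSeq G θ (S ω)),
        -- `T` is connected, and almost surely its sets of active nodes are not empty
        (∀ ω, TechDiffusion.IsConnectedSeq G (T ω)) ∧
        (∀ᵐ ω ∂μ, ∀ t, 1 ≤ t → t ≤ n → (TechDiffusion.activeAt (T ω) t).Nonempty) ∧
        -- nodes that are not seeds respect their thresholds
        (∀ ω, ∀ v, v ∉ S ω → (θ v : ℕ∞) ≤ T ω v) ∧
        -- the distribution of `T`
        (∀ v, ∀ t, 1 ≤ t → t ≤ n →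
          (1 / (12 * (1 + ε)) ≤ ∑ t' ∈ Finset.Icc 1 t, x v t' →
            1 - ε / (4 * (n : ℝ) ^ 2) ≤ μ.real {ω | T ω v ≤ t}) ∧
          (∑ t' ∈ Finset.Icc 1 t, x v t' < 1 / (12 * (1 + ε)) →
            (1 + ε) * ∑ t' ∈ Finset.Icc 1 t, x v t' ≤ μ.real {ω | T ω v ≤ t})) := by
  refine ⟨TechDiffusion.efficientlyComputable_getSeq, fun n G hG θ hθ s =>
    ⟨fun x => TechDiffusion.augmentedIP_iff fun v => (hθ v).1,
      ⟨TechDiffusion.wellFounded_glueStep G, TechDiffusion.exists_glueReturns hG⟩, ?_⟩⟩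
  intro ε hε hεn x hx glue hglue Ω _ μ _ S₀ hS₀ S hS T hT
  have hα := TechDiffusion.one_le_samplingBias hε hεn
  have hw : ∀ v, 0 ≤ TechDiffusion.samplingBias n ε * TechDiffusion.seedWeight θ x v := fun v =>
    mul_nonneg (by linarith) (TechDiffusion.seedWeight_nonneg hx.simple v)
  have hsub : ∀ ω, S₀ ω ⊆ S ω := fun ω => hS ω ▸ (hglue (S₀ ω)).subset
  refine ⟨fun ω => ?_, ?_, fun ω v hv => ?_, fun v t h1 ht => ?_⟩
  · rw [hT ω]
    exact TechDiffusion.isConnectedSeq_getSeq (hS ω ▸ (hglue (S₀ ω)).2)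
  · filter_upwards [hS₀.ae_mem_source hα (fun v => (hθ v).1) hx] with ω hω t h1 ht
    refine ⟨s, ?_⟩
    rw [hT ω]
    exact (TechDiffusion.getSeq_le_iff h1 ht s).2 (TechDiffusion.flag_of_mem n (hsub ω hω))
  · rw [hT ω]
    exact TechDiffusion.threshold_le_getSeq hv
  -- `W` does not depend on the sample, so independence applies to it; `hsub` carries its seeds over
  -- to the glued set.
  · obtain ⟨W, hW, hact⟩ := TechDiffusion.exists_activating_set (fun v => (hθ v).1) hx v h1 ht
    have hprob := hS₀.le_measureReal hw W (A := {ω | T ω v ≤ t}) fun w hwW ω hmem => by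
      change T ω v ≤ t
      rw [hT ω]
      exact hact w hwW _ (hsub ω hmem)
    refine ⟨fun hy => (TechDiffusion.exp_bound_of_large hε hεn hy hW).trans hprob, fun hy =>
      (TechDiffusion.exp_bound_of_small hε hεn (Finset.sum_nonneg fun t' ht' => ?_) hy hW).trans
        hprob⟩
    exact hx.simple.nonneg v t' (Finset.Icc_subset_Icc le_rfl ht ht')
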